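/- Let $d\ge 1$, $p\in(1,\infty)$, $s\in(0,1)$, and $q\in[1,p_s^*)$, where $p_s^*=\frac{dp}{d-sp}$ if $sp<d$ and $p_s^*=\infty$ if $sp\ge d$. Let $\Omega\subset\mathbb{R}^d$ be a bounded open set and let $$W^{s,p}_0(\Omega)=\{u\in L^p(\mathbb{R}^d):\ [u]_{s,p}<\infty,\ u=0 \text{ a.e. in } \mathbb{R}^d\setminus\Omega\},\qquad [u]_{s,p}^p=\iint_{\mathbb{R}^d\times\mathbb{R}^d}\frac{|u(x)-u(y)|^p}{|x-y|^{d+sp}}\,dx\,dy .$$ Let $\lambda\in\mathbb{R}$ and let $u\in W^{s,p}_0(\Omega)$, $u\ge 0$ a.e., be a weak solution of the $q$-eigenvalue problem $(-\Delta_p)^s u=\lambda|u|^{q-2}u$ in $\Omega$, $u=0$ in $\mathbb{R}^d\setminus\Omega$, that is, $$\iint_{\mathbb{R}^d\times\mathbb{R}^d}\frac{|u(x)-u(y)|^{p-2}(u(x)-u(y))}{|x-y|^{d+sp}}\,(\varphi(x)-\varphi(y))\,dx\,dy=\lambda\int_\Omega |u|^{q-2}u\,\varphi\,dx\qquad\text{for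 all }\varphi\in W^{s,p}_0(\Omega),$$ where expressions $|t|^{r-2}t$ are read as $0$ at $t=0$. Then $u\in L^\infty(\mathbb{R}^d)$, i.e. $u$ is (essentially) bounded on $\mathbb{R}^d$. In particular this holds for $\lambda=\inf\{[v]_{s,p}^p: v\in W^{s,p}_0(\Omega),\ \|v\|_{L^q(\Omega)}=1\}$ and $\|u\|_{L^q(\Omega)}=1$. -/

import Mathlib

open MeasureTheory
open scoped ENNReal

noncomputable section

namespace FracPLap

/-- The fractional critical Sobolev exponent: `d p / (d - s p)` if `s p < d`, and `∞` otherwise. -/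
def criticalExponent (d : ℕ) (s p : ℝ) : EReal :=
  if s * p < (d : ℝ) then (((d : ℝ) * p / ((d : ℝ) - s * p) : ℝ) : EReal) else ⊤

/-- The Gagliardo seminorm `[u]_{s,p}` on `ℝ^d`, as an extended nonnegative real:
the `p`-th root of the integral of `|u x - u y|^p / |x - y|^(d + s p)` over `ℝ^d × ℝ^d`. -/
def gagliardoSeminorm {d : ℕ} (s p : ℝ) (u : EuclideanSpace ℝ (Fin d) → ℝ) : ℝ≥0∞ :=
  (∫⁻ z : EuclideanSpace ℝ (Fin d) × EuclideanSpace ℝ (Fin d),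
    ENNReal.ofReal (|u z.1 - u z.2| ^ p / ‖z.1 - z.2‖ ^ ((d : ℝ) + s * p))) ^ (1 / p)

/-- Membership in `W^{s,p}_0(Ω)`: `u ∈ L^p(ℝ^d)`, `[u]_{s,p} < ∞`, and `u = 0` almost everywhere
outside `Ω`. Elements are represented by functions; everything is invariant under changes on
null sets. -/
structure MemW0 {d : ℕ} (s p : ℝ) (Ω : Set (EuclideanSpace ℝ (Fin d)))
    (u : EuclideanSpace ℝ (Fin d) → ℝ) : Prop where
  memLp : MemLp u (ENNReal.ofReal p) volume
  seminorm_lt_top : gagliardoSeminorm s p u < ∞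
  eq_zero_outside : ∀ᵐ x ∂volume, x ∉ Ω → u x = 0

/-- The weak form of the fractional `p`-Laplacian of `u`, tested against `φ`. The integrand is
integrable whenever both seminorms `[u]_{s,p}`, `[φ]_{s,p}` are finite (Hölder's inequality). -/
def weakForm {d : ℕ} (s p : ℝ) (u φ : EuclideanSpace ℝ (Fin d) → ℝ) : ℝ :=
  ∫ z : EuclideanSpace ℝ (Fin d) × EuclideanSpace ℝ (Fin d),
    |u z.1 - u z.2| ^ (p - 2) * (u z.1 - u z.2) * (φ z.1 - φ z.2) /
      ‖z.1 - z.2‖ ^ ((d : ℝ) + s * p)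

/-- `u ∈ W^{s,p}_0(Ω)` is a weak solution of `(-Δ_p)^s u = lam * |u|^{q-2} u` in `Ω`, `u = 0` in
`ℝ^d \ Ω`. The test functions are all of `W^{s,p}_0(Ω)`. For bounded `Ω` and `1 ≤ q < p_s^*` the
right-hand integrand is integrable, because `W^{s,p}_0(Ω)` embeds in `L^q(Ω)`. -/
structure IsWeakSolution {d : ℕ} (s p q lam : ℝ) (Ω : Set (EuclideanSpace ℝ (Fin d)))
    (u : EuclideanSpace ℝ (Fin d) → ℝ) : Prop where
  memW0 : MemW0 s p Ω u
  weak_eq : ∀ φ : EuclideanSpace ℝ (Fin d) → ℝ, MemW0 s p Ω φ →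
    weakForm s p u φ = lam * ∫ x in Ω, |u x| ^ (q - 2) * u x * φ x

end FracPLap

end

namespace FracPLap

/-! De Giorgi truncation. Testing the equation with (u - k)₊ bounds the energy of that truncation by
|λ| ∫ u^(q-1) (u - k)₊ (`IsWeakSolution.gagliardoEnergy_truncation_le`). A subcritical Sobolev
inequality (`exists_lintegral_rpow_le_of_gagliardoEnergy_le`) turns this into a bound on ∫ (u -
k)₊^r for some r > max(p, q). Along levels κ_n increasing to M, Y_n = ∫ (u - κ_n)₊^r then satisfies
Y_{n+1} ≤ S (D M^(-(r-q)) b^n Y_n)^γ with γ = r/p > 1. Since r > q, a large M makes the prefactor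
small, so Y_n → 0 geometrically and u ≤ M a.e. (`ae_le_of_truncation_estimate`).

The Sobolev inequality comes from distribution functions: around a point with v > 2t, a ball of
twice the volume of {v > t} is at least half filled by {v ≤ t}, so the energy controls |{v > 2t}|.
Iterating over dyadic levels gives weak-type decay of order p/(1-θ), and boundedness of Ω upgrades
it to L^r for smaller r. -/

/-- The `p`-th power of the Gagliardo seminorm. -/
noncomputable def gagliardoEnergy {d : ℕ} (s p : ℝ) (u : EuclideanSpace ℝ (Fin d) → ℝ) : ℝ≥0∞ :=
  ∫⁻ z : EuclideanSpace ℝ (Fin d) × EuclideanSpace ℝ (Fin d),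
    ENNReal.ofReal (|u z.1 - u z.2| ^ p / ‖z.1 - z.2‖ ^ ((d : ℝ) + s * p))

/-! ### Subcritical Sobolev inequality via distribution functions -/

/-- For v x > 2t, the part of the ball of radius ρ about x where v ≤ t has measure at least m; there
|v x - v y| ≥ t and |x - y| ≤ ρ, which bounds the kernel below. -/
theorem measure_superlevel_mul_le_gagliardoEnergy {d : ℕ} {s p : ℝ} (hs : 0 < s) (hp : 0 < p)
    {v : EuclideanSpace ℝ (Fin d) → ℝ} (hv : Measurable v) {t ρ : ℝ} (ht : 0 < t)
    {m : ℝ≥0∞} (hm : m ≠ ∞) (hE : volume {x | t < v x} ≤ m)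
    (hρ : ∀ x : EuclideanSpace ℝ (Fin d), volume (Metric.ball x ρ) = m + m) :
    volume {x | 2 * t < v x} * (ENNReal.ofReal (t ^ p / ρ ^ ((d : ℝ) + s * p)) * m)
      ≤ gagliardoEnergy s p v := by
  have hA : MeasurableSet {x | 2 * t < v x} := measurableSet_lt measurable_const hv
  have hEm : MeasurableSet {x | t < v x} := measurableSet_lt measurable_const hv
  rw [gagliardoEnergy, Measure.volume_eq_prod, lintegral_prod _ (by fun_prop), mul_comm]
  calc _ = ∫⁻ _ in {x | 2 * t < v x}, ENNReal.ofReal (t ^ p / ρ ^ ((d : ℝ) + s * p)) * m := by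
        rw [setLIntegral_const]
    _ ≤ ∫⁻ x in {x | 2 * t < v x}, ∫⁻ y,
          ENNReal.ofReal (|v x - v y| ^ p / ‖x - y‖ ^ ((d : ℝ) + s * p)) := by
        refine setLIntegral_mono' hA fun x hx ↦ ?_
        have hx' : 2 * t < v x := hx
        have hvol : m ≤ volume (Metric.ball x ρ \ {x | t < v x}) := by
          refine le_trans ?_ (le_measure_sdiff (s₁ := Metric.ball x ρ) (s₂ := {x | t < v x}))
          rw [hρ x]
          exact ENNReal.le_sub_of_add_le_right (ne_top_of_le_ne_top hm hE) (by gcongr)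
        calc ENNReal.ofReal (t ^ p / ρ ^ ((d : ℝ) + s * p)) * m
            ≤ ENNReal.ofReal (t ^ p / ρ ^ ((d : ℝ) + s * p))
                * volume (Metric.ball x ρ \ {x | t < v x}) := by gcongr
          _ = ∫⁻ _ in Metric.ball x ρ \ {x | t < v x},
                ENNReal.ofReal (t ^ p / ρ ^ ((d : ℝ) + s * p)) := by rw [setLIntegral_const]
          _ ≤ ∫⁻ y in Metric.ball x ρ \ {x | t < v x},
                ENNReal.ofReal (|v x - v y| ^ p / ‖x - y‖ ^ ((d : ℝ) + s * p)) := by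
              refine setLIntegral_mono' (measurableSet_ball.diff hEm) fun y hy ↦ ?_
              have hy1 : dist y x < ρ := hy.1
              have hy2 : v y ≤ t := not_lt.mp hy.2
              have hne : x ≠ y := by
                rintro rfl
                linarith
              have hpos : 0 < ‖x - y‖ := norm_pos_iff.mpr (sub_ne_zero.mpr hne)
              have hlt : ‖x - y‖ ≤ ρ := by
                rw [← dist_eq_norm, dist_comm]
                exact hy1.le
              have habs : t ≤ |v x - v y| := le_trans (by linarith) (le_abs_self _)
              gcongr
          _ ≤ _ := setLIntegral_le_lintegral _ _
    _ ≤ _ := setLIntegral_le_lintegral _ _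

/-- A dyadic decay inequality for a bounded distribution function gives weak-type decay. -/
theorem le_rpow_of_dyadic_decay {m : ℝ → ℝ} {V B p θ : ℝ} (hp : 0 < p) (hθ0 : 0 < θ)
    (hθ1 : θ < 1) (hB : 0 < B) (hm0 : ∀ t, 0 ≤ m t) (hmV : ∀ t, 0 < t → m t ≤ V)
    (h : ∀ t, 0 < t → m (2 * t) ≤ B * t ^ (-p) * m t ^ θ) {t : ℝ} (ht : 0 < t) :
    m t ≤ (2 ^ (p / (1 - θ)) * B) ^ (1 / (1 - θ)) * t ^ (-(p / (1 - θ))) := by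
  have h1θ : 0 < 1 - θ := by linarith
  set r := p / (1 - θ) with hr
  have hr0 : 0 < r := by positivity
  have hrp : r = p + r * θ := by
    rw [hr]
    field_simp
    ring
  -- G is the fixed point of g ↦ 2^r B g^θ, so the bound t^r m(t) ≤ G passes from t to 2t.
  set G := (2 ^ r * B) ^ (1 / (1 - θ)) with hG
  have hG0 : 0 < G := by positivity
  have hGG : 2 ^ r * B * G ^ θ = G := by
    have h1 : 2 ^ r * B = G ^ (1 - θ) := by
      rw [hG, ← Real.rpow_mul (by positivity), one_div_mul_cancel h1θ.ne', Real.rpow_one]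
    rw [h1, ← Real.rpow_add hG0, sub_add_cancel, Real.rpow_one]
  have hstep : ∀ t, 0 < t → t ^ r * m t ≤ G → (2 * t) ^ r * m (2 * t) ≤ G := by
    intro t ht hg
    calc (2 * t) ^ r * m (2 * t) ≤ (2 * t) ^ r * (B * t ^ (-p) * m t ^ θ) := by
          gcongr
          exact h t ht
      _ = 2 ^ r * B * (t ^ r * m t) ^ θ := by
          rw [Real.mul_rpow (by norm_num) ht.le, Real.mul_rpow (by positivity) (hm0 t),
            ← Real.rpow_mul ht.le, show r * θ = r + -p by linarith, Real.rpow_add ht]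
          ring
      _ ≤ 2 ^ r * B * G ^ θ := by
          gcongr
          exact mul_nonneg (by positivity) (hm0 t)
      _ = G := hGG
  -- For small t the bound by V already gives the claim; every t gets there after finitely many
  -- halvings.
  have hind : ∀ n : ℕ, ∀ t, 0 < t → t ^ r * V ≤ G * (2 ^ r) ^ n → t ^ r * m t ≤ G := by
    intro n
    induction n with
    | zero =>
      intro t ht hb
      rw [pow_zero, mul_one] at hb
      exact le_trans (by gcongr; exact hmV t ht) hb
    | succ n ih =>
      intro t ht hb
      have h2 : (0 : ℝ) < 2 ^ r := by positivity
      have := hstep (t / 2) (by positivity) (ih (t / 2) (by positivity) (by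
        rw [Real.div_rpow ht.le (by norm_num), div_mul_eq_mul_div, div_le_iff₀ h2, mul_assoc,
          ← pow_succ]
        exact hb))
      rwa [mul_div_cancel₀ t (by norm_num)] at this
  obtain ⟨n, hn⟩ := pow_unbounded_of_one_lt (t ^ r * V / G)
    (Real.one_lt_rpow (x := 2) (by norm_num) hr0)
  have := hind n t ht (by
    rw [div_lt_iff₀ hG0] at hn
    linarith)
  rw [Real.rpow_neg ht.le, ← div_eq_mul_inv, le_div_iff₀ (by positivity)]
  linarith

/-- A weak-type bound on a set of finite measure gives strong-type bounds of lower exponent. -/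
theorem lintegral_rpow_le_of_weak_type {α : Type*} [MeasurableSpace α] {ν : Measure α}
    {v : α → ℝ} (hv : Measurable v) (hv0 : ∀ x, 0 ≤ v x) {r r₀ V N K : ℝ} (hr : 0 < r)
    (hrr : r < r₀) (hV : 0 ≤ V) (hN : 0 ≤ N) (hK : 0 < K)
    (h₁ : ∀ t, 0 < t → ν {x | t < v x} ≤ ENNReal.ofReal V)
    (h₂ : ∀ t, 0 < t → ν {x | t < v x} ≤ ENNReal.ofReal (N * K ^ r₀ * t ^ (-r₀))) :
    ∫⁻ x, ENNReal.ofReal (v x ^ r) ∂ν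
      ≤ ENNReal.ofReal ((V + r * N / (r₀ - r)) * K ^ r) := by
  have hd : 0 < r₀ - r := by linarith
  have hlow : ∫⁻ t in Set.Ioc 0 K, ν {x | t < v x} * ENNReal.ofReal (t ^ (r - 1))
      ≤ ENNReal.ofReal (V * (K ^ r / r)) := by
    have hint : IntegrableOn (fun t : ℝ ↦ t ^ (r - 1)) (Set.Ioc 0 K) := by
      rw [← intervalIntegrable_iff_integrableOn_Ioc_of_le hK.le]
      exact intervalIntegral.intervalIntegrable_rpow' (by linarith)
    calc _ ≤ ∫⁻ t in Set.Ioc 0 K, ENNReal.ofReal V * ENNReal.ofReal (t ^ (r - 1)) := by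
          refine setLIntegral_mono' measurableSet_Ioc fun t ht ↦ ?_
          gcongr
          exact h₁ t ht.1
      _ = _ := by
          rw [lintegral_const_mul' _ _ ENNReal.ofReal_ne_top,
            ← ofReal_integral_eq_lintegral_ofReal hint, ← intervalIntegral.integral_of_le hK.le,
            integral_rpow (Or.inl (by linarith)), ← ENNReal.ofReal_mul hV, sub_add_cancel,
            Real.zero_rpow hr.ne', sub_zero]
          filter_upwards [ae_restrict_mem measurableSet_Ioc] with t ht
          exact Real.rpow_nonneg ht.1.le _
  have hhigh : ∫⁻ t in Set.Ioi K, ν {x | t < v x} * ENNReal.ofReal (t ^ (r - 1))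
      ≤ ENNReal.ofReal (N * K ^ r / (r₀ - r)) := by
    have hlt : r - 1 - r₀ < -1 := by linarith
    calc _ ≤ ∫⁻ t in Set.Ioi K, ENNReal.ofReal (N * K ^ r₀)
            * ENNReal.ofReal (t ^ (r - 1 - r₀)) := by
          refine setLIntegral_mono' measurableSet_Ioi fun t ht ↦ ?_
          have ht0 : 0 < t := hK.trans ht
          calc _ ≤ ENNReal.ofReal (N * K ^ r₀ * t ^ (-r₀)) * ENNReal.ofReal (t ^ (r - 1)) := by
                gcongr
                exact h₂ t ht0
            _ = _ := by
                rw [← ENNReal.ofReal_mul (by positivity), ← ENNReal.ofReal_mul (by positivity),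
                  mul_assoc, ← Real.rpow_add ht0]
                ring_nf
      _ = _ := by
          rw [lintegral_const_mul' _ _ ENNReal.ofReal_ne_top,
            ← ofReal_integral_eq_lintegral_ofReal (integrableOn_Ioi_rpow_of_lt hlt hK),
            integral_Ioi_rpow_of_lt hlt hK, ← ENNReal.ofReal_mul (by positivity)]
          · congr 1
            rw [show r - 1 - r₀ + 1 = -(r₀ - r) by ring, neg_div_neg_eq, mul_div_assoc', mul_assoc,
              ← Real.rpow_add hK]
            congr 3
            ring
          · filter_upwards [ae_restrict_mem measurableSet_Ioi] with t ht
            exact Real.rpow_nonneg (hK.trans ht).le _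
  -- Layer cake, split at height K: the bound V serves below K, the decay t^(-r₀) above.
  rw [lintegral_rpow_eq_lintegral_meas_lt_mul ν (Filter.Eventually.of_forall hv0) hv.aemeasurable
    hr, ← Set.Ioc_union_Ioi_eq_Ioi hK.le]
  calc _ ≤ ENNReal.ofReal r * (ENNReal.ofReal (V * (K ^ r / r))
          + ENNReal.ofReal (N * K ^ r / (r₀ - r))) := by
        gcongr
        exact (lintegral_union_le _ _ _).trans (add_le_add hlow hhigh)
    _ = _ := by
        rw [← ENNReal.ofReal_add (by positivity) (by positivity), ← ENNReal.ofReal_mul hr.le]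
        congr 1
        field_simp

/-- The distribution function of a function of finite Gagliardo energy decays dyadically. -/
theorem measureReal_superlevel_two_mul_le {d : ℕ} (hd : 1 ≤ d) {s p θ V : ℝ} (hs : 0 < s)
    (hp : 0 < p) (hθ : θ ≤ s * p / d) (hV : 0 < V) :
    ∃ C : ℝ, 0 < C ∧ ∀ v : EuclideanSpace ℝ (Fin d) → ℝ, Measurable v →
      (∀ t, 0 < t → volume {x | t < v x} ≤ ENNReal.ofReal V) → ∀ K : ℝ, 0 < K →
      gagliardoEnergy s p v ≤ ENNReal.ofReal (K ^ p) → ∀ t : ℝ, 0 < t →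
      volume.real {x | 2 * t < v x} ≤ C * K ^ p * t ^ (-p) * volume.real {x | t < v x} ^ θ := by
  have hd0 : (0 : ℝ) < d := by exact_mod_cast hd
  set ω : ℝ := volume.real (Metric.ball (0 : EuclideanSpace ℝ (Fin d)) 1) with hω
  have hω0 : 0 < ω :=
    ENNReal.toReal_pos (Metric.measure_ball_pos _ _ one_pos).ne' measure_ball_lt_top.ne
  -- The power of V pays for lowering the exponent sp/d to θ, needed when sp ≥ d because the
  -- iteration requires θ < 1.
  refine ⟨(2 / ω) ^ (1 + s * p / d) * V ^ (s * p / d - θ), by positivity, ?_⟩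
  intro v hv hvV K hK hE t ht
  have hfin : ∀ t, 0 < t → volume {x | t < v x} ≠ ∞ := fun t ht ↦
    ne_top_of_le_ne_top ENNReal.ofReal_ne_top (hvV t ht)
  set m := volume.real {x | t < v x} with hm
  have hmV : m ≤ V := ENNReal.toReal_le_of_le_ofReal hV.le (hvV t ht)
  have hm_nonneg : 0 ≤ m := measureReal_nonneg
  rcases hm_nonneg.eq_or_lt with h0 | h0
  · have : volume.real {x | 2 * t < v x} ≤ m :=
      measureReal_mono (fun x hx ↦ (show t < 2 * t by linarith).trans hx) (hfin t ht)
    rw [← h0] at this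
    exact this.trans (by positivity)
  · have hm0 : m ≠ 0 := h0.ne'
    -- The radius at which a ball has volume 2m.
    set ρ : ℝ := (2 * m / ω) ^ (1 / (d : ℝ)) with hρ
    have hρ0 : 0 < ρ := by positivity
    have hρd : ρ ^ (d : ℝ) = 2 * m / ω := by
      rw [hρ, ← Real.rpow_mul (by positivity), one_div_mul_cancel hd0.ne', Real.rpow_one]
    have hball : ∀ x : EuclideanSpace ℝ (Fin d),
        volume (Metric.ball x ρ) = ENNReal.ofReal m + ENNReal.ofReal m := by
      intro x
      rw [Measure.addHaar_ball_of_pos _ _ hρ0, finrank_euclideanSpace_fin, ← Real.rpow_natCast,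
        hρd, ← ENNReal.ofReal_toReal (measure_ball_lt_top (μ := volume)
          (x := (0 : EuclideanSpace ℝ (Fin d))) (r := 1)).ne, ← measureReal_def, ← hω,
        ← ENNReal.ofReal_mul (by positivity), ← ENNReal.ofReal_add h0.le h0.le]
      congr 1
      field_simp
      ring
    have key := (measure_superlevel_mul_le_gagliardoEnergy hs hp hv ht ENNReal.ofReal_ne_top
      (by rw [hm, ofReal_measureReal (hfin t ht)]) hball).trans hE
    rw [← ofReal_measureReal (hfin (2 * t) (by positivity)), ← ENNReal.ofReal_mul (by positivity),
      ← ENNReal.ofReal_mul (by positivity), ENNReal.ofReal_le_ofReal_iff (by positivity)] at key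
    have hρsp : ρ ^ (s * p) ≤ (2 / ω) ^ (s * p / d) * (V ^ (s * p / d - θ) * m ^ θ) := by
      rw [hρ, ← Real.rpow_mul (by positivity), one_div_mul_eq_div, mul_div_right_comm,
        Real.mul_rpow (by positivity) h0.le]
      gcongr
      calc m ^ (s * p / d) = m ^ (s * p / d - θ) * m ^ θ := by
            rw [← Real.rpow_add h0, sub_add_cancel]
        _ ≤ _ := by
            gcongr
    rw [Real.rpow_add hρ0, hρd] at key
    have h1 : volume.real {x | 2 * t < v x} * (ω / 2) * (t ^ p / ρ ^ (s * p)) ≤ K ^ p := by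
      refine le_of_eq_of_le ?_ key
      field_simp
    rw [mul_div_assoc', div_le_iff₀ (by positivity)] at h1
    calc volume.real {x | 2 * t < v x}
        = volume.real {x | 2 * t < v x} * (ω / 2) * t ^ p * (2 / ω * t ^ (-p)) := by
          rw [Real.rpow_neg ht.le]
          field_simp
      _ ≤ K ^ p * ((2 / ω) ^ (s * p / d) * (V ^ (s * p / d - θ) * m ^ θ))
            * (2 / ω * t ^ (-p)) := by
          exact mul_le_mul_of_nonneg_right
            (h1.trans (mul_le_mul_of_nonneg_left hρsp (by positivity))) (by positivity)
      _ = _ := by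
          rw [Real.rpow_add (by positivity), Real.rpow_one]
          ring

/-- Subcritical fractional Sobolev inequality for nonnegative functions vanishing outside a
bounded set. -/
theorem exists_lintegral_rpow_le_of_gagliardoEnergy_le {d : ℕ} (hd : 1 ≤ d) {s p θ r : ℝ}
    (hs : 0 < s) (hp : 0 < p) (hθ0 : 0 < θ) (hθ1 : θ < 1) (hθ : θ ≤ s * p / d) (hr : 0 < r)
    (hrθ : r < p / (1 - θ)) {Ω : Set (EuclideanSpace ℝ (Fin d))} (hΩ : Bornology.IsBounded Ω) :
    ∃ S : ℝ, ∀ v : EuclideanSpace ℝ (Fin d) → ℝ, Measurable v → (∀ x, 0 ≤ v x) →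
      (∀ x ∉ Ω, v x = 0) → ∀ K : ℝ, 0 < K →
      gagliardoEnergy s p v ≤ ENNReal.ofReal (K ^ p) →
      ∫⁻ x, ENNReal.ofReal (v x ^ r) ≤ ENNReal.ofReal (S * K ^ r) := by
  set V : ℝ := volume.real Ω + 1 with hVdef
  have hV : 0 < V := by positivity
  obtain ⟨C, hC0, hC⟩ := measureReal_superlevel_two_mul_le hd hs hp hθ hV
  have h1θ : 0 < 1 - θ := by linarith
  set r₀ := p / (1 - θ) with hr₀
  set N : ℝ := (2 ^ r₀ * C) ^ (1 / (1 - θ)) with hN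
  refine ⟨V + r * N / (r₀ - r), fun v hv hv0 hvΩ K hK hE ↦ ?_⟩
  have hvV : ∀ t, 0 < t → volume {x | t < v x} ≤ ENNReal.ofReal V := by
    intro t ht
    calc volume {x | t < v x} ≤ volume Ω := by
          refine measure_mono fun x hx ↦ ?_
          by_contra hxΩ
          have hx' : t < v x := hx
          rw [hvΩ x hxΩ] at hx'
          linarith
      _ = ENNReal.ofReal (volume.real Ω) := (ofReal_measureReal hΩ.measure_lt_top.ne).symm
      _ ≤ _ := ENNReal.ofReal_le_ofReal (by linarith)
  refine lintegral_rpow_le_of_weak_type hv hv0 hr hrθ hV.le (by positivity) hK hvV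
    fun t ht ↦ ?_
  rw [← ofReal_measureReal (ne_top_of_le_ne_top ENNReal.ofReal_ne_top (hvV t ht))]
  refine ENNReal.ofReal_le_ofReal ?_
  have := le_rpow_of_dyadic_decay (m := fun t ↦ volume.real {x | t < v x}) (V := V)
    (B := C * K ^ p) hp hθ0 hθ1 (by positivity) (fun _ ↦ measureReal_nonneg)
    (fun t ht ↦ ENNReal.toReal_le_of_le_ofReal hV.le (hvV t ht)) (hC v hv hvV K hK hE) ht
  refine this.trans_eq ?_
  rw [← mul_assoc, Real.mul_rpow (by positivity) (by positivity), ← Real.rpow_mul hK.le,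
    mul_one_div]

/-! ### De Giorgi iteration -/

/-- The pointwise estimate behind one truncation step, for levels `k < k' ≤ M` at distance
`M / c`. -/
theorem truncation_step_pointwise {q r : ℝ} (hq : 1 ≤ q) (hqr : q < r) {u k k' M c : ℝ}
    (hu : 0 ≤ u) (hM : 0 < M) (hc : 1 ≤ c) (hkM : k ≤ M) (hkk : k' - k = M / c) :
    u ^ (q - 1) * max (u - k') 0 ≤
      2 ^ (q - 1) * c ^ (r - 1) * M ^ (-(r - q)) * max (u - k) 0 ^ r := by
  have hc0 : 0 < c := by linarith
  have ha : 0 < M / c := by positivity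
  rcases le_or_gt u k' with h | h
  · rw [max_eq_right (by linarith), mul_zero]
    positivity
  · rw [max_eq_left (by linarith), max_eq_left (by linarith)]
    set w := u - k with hw
    have hwa : M / c ≤ w := by linarith
    have hw0 : 0 < w := by linarith
    have hMw : M ≤ c * w := by
      rw [div_le_iff₀ hc0] at hwa
      linarith
    -- u = w + k ≤ w + M, and both w and M are at most c w.
    have huw : u ≤ 2 * c * w := by nlinarith
    have h1 : u ^ (q - 1) ≤ (2 * c * w) ^ (q - 1) :=
      Real.rpow_le_rpow hu huw (by linarith)
    have h2 : w ^ (-(r - q)) ≤ (M / c) ^ (-(r - q)) :=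
      Real.rpow_le_rpow_of_nonpos ha hwa (by linarith)
    calc u ^ (q - 1) * (u - k') ≤ (2 * c * w) ^ (q - 1) * w := by
          apply mul_le_mul h1 (by linarith) (by linarith) (by positivity)
      _ = 2 ^ (q - 1) * c ^ (q - 1) * (w ^ r * w ^ (-(r - q))) := by
          rw [Real.mul_rpow (by positivity) hw0.le, Real.mul_rpow (by norm_num) hc0.le,
            ← Real.rpow_add hw0, mul_assoc, mul_assoc, mul_assoc]
          congr 2
          rw [← Real.rpow_add_one hw0.ne']
          congr 1
          ring
      _ ≤ 2 ^ (q - 1) * c ^ (q - 1) * (w ^ r * (M / c) ^ (-(r - q))) := by gcongr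
      _ = _ := by
          rw [Real.div_rpow hM.le hc0.le, Real.rpow_neg hc0.le (r - q),
            show r - 1 = (q - 1) + (r - q) by ring, Real.rpow_add hc0]
          field_simp

/-- De Giorgi iteration: if the truncations of `u` satisfy a superlinear Caccioppoli–Sobolev
inequality, then `u` is essentially bounded. -/
theorem ae_le_of_truncation_estimate {α : Type*} [MeasurableSpace α] {ν : Measure α}
    {p q r C S : ℝ} (hp : 0 < p) (hq : 1 ≤ q) (hqr : q < r) (hpr : p < r) (hC : 0 < C)
    {u : α → ℝ} (hum : Measurable u) (hu0 : ∀ x, 0 ≤ u x)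
    (hur : ∫⁻ x, ENNReal.ofReal (u x ^ r) ∂ν < ∞)
    (h : ∀ k K : ℝ, 0 ≤ k → 0 < K →
      ENNReal.ofReal C * ∫⁻ x, ENNReal.ofReal (u x ^ (q - 1) * max (u x - k) 0) ∂ν
        ≤ ENNReal.ofReal (K ^ p) →
      ∫⁻ x, ENNReal.ofReal (max (u x - k) 0 ^ r) ∂ν ≤ ENNReal.ofReal (S * K ^ r)) :
    ∃ M : ℝ, ∀ᵐ x ∂ν, u x ≤ M := by
  have hr : 0 < r := by linarith
  set γ := r / p with hγ
  have hγ1 : 1 < γ := by rwa [hγ, one_lt_div hp]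
  set b : ℝ := 2 ^ (r - 1) with hb
  have hb1 : 1 < b := Real.one_lt_rpow (by norm_num) (by linarith)
  have hb0 : 0 < b := by linarith
  -- The decay rate solving (bη)^γ = η, so that the superlinear power γ absorbs the growth b^n
  -- caused by the shrinking gaps between levels.
  set η : ℝ := b ^ (-(γ / (γ - 1))) with hη
  have hη0 : 0 < η := Real.rpow_pos_of_pos hb0 _
  have hη1 : η < 1 := Real.rpow_lt_one_of_one_lt_of_neg hb1
    (neg_lt_zero.mpr (div_pos (by linarith) (by linarith)))
  have hbη : (b * η) ^ γ = η := by
    have : b * η = b ^ (1 + -(γ / (γ - 1))) := by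
      rw [Real.rpow_add hb0, Real.rpow_one]
    rw [this, ← Real.rpow_mul hb0.le, hη]
    congr 1
    have : γ - 1 ≠ 0 := by linarith
    field_simp
    ring
  set A : ℝ := (∫⁻ x, ENNReal.ofReal (u x ^ r) ∂ν).toReal + 1 with hA
  have hA0 : 0 < A := by positivity
  set D : ℝ := C * (2 ^ (q - 1) * 4 ^ (r - 1)) with hD
  have hD0 : 0 < D := by positivity
  obtain ⟨M, hM0, hM⟩ : ∃ M : ℝ, 0 < M ∧ S * (D * M ^ (-(r - q)) * A) ^ γ ≤ A * η := by
    have h1 : Filter.Tendsto (fun M : ℝ ↦ S * (D * M ^ (-(r - q)) * A) ^ γ) Filter.atTop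
        (nhds (S * (D * 0 * A) ^ γ)) := by
      refine (((tendsto_rpow_neg_atTop (by linarith)).const_mul D).mul_const A).rpow_const
        (Or.inr (by linarith)) |>.const_mul S
    rw [mul_zero, zero_mul, Real.zero_rpow (by linarith), mul_zero] at h1
    obtain ⟨M, hM1, hM2⟩ := ((h1.eventually (gt_mem_nhds (mul_pos hA0 hη0))).and
      (Filter.eventually_gt_atTop 0)).exists
    exact ⟨M, hM2, hM1.le⟩
  -- The levels rise from M/2 to M with gaps M / (4·2^n), whence c = 4·2^n below.
  set κ : ℕ → ℝ := fun n ↦ M * (1 - (1 / 2) ^ (n + 1)) with hκ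
  have hκ0 : ∀ n, 0 ≤ κ n := fun n ↦
    mul_nonneg hM0.le (sub_nonneg.mpr (pow_le_one₀ (by norm_num) (by norm_num)))
  have hκM : ∀ n, κ n ≤ M := fun n ↦ by
    have : (0 : ℝ) < (1 / 2) ^ (n + 1) := by positivity
    simp only [hκ]
    nlinarith
  have hY : ∀ n, ∫⁻ x, ENNReal.ofReal (max (u x - κ n) 0 ^ r) ∂ν
      ≤ ENNReal.ofReal (A * η ^ n) := by
    intro n
    induction n with
    | zero =>
      calc ∫⁻ x, ENNReal.ofReal (max (u x - κ 0) 0 ^ r) ∂ν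
          ≤ ∫⁻ x, ENNReal.ofReal (u x ^ r) ∂ν := by
            gcongr with x
            exact max_le (by linarith [hκ0 0]) (hu0 x)
        _ ≤ _ := by
            rw [pow_zero, mul_one, hA, ← ENNReal.ofReal_toReal hur.ne]
            exact ENNReal.ofReal_le_ofReal (by simp)
    | succ n ih =>
      -- Q bounds the right-hand side of the Caccioppoli inequality at level κ (n + 1), given the
      -- induction hypothesis.
      set Q : ℝ := D * M ^ (-(r - q)) * A * (b * η) ^ n with hQ
      have hQ0 : 0 < Q := by positivity
      have key := h (κ (n + 1)) (Q ^ (1 / p)) (hκ0 _) (by positivity) ?_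
      · refine key.trans (ENNReal.ofReal_le_ofReal ?_)
        rw [← Real.rpow_mul hQ0.le, one_div_mul_eq_div, ← hγ, hQ,
          Real.mul_rpow (by positivity) (by positivity), ← Real.rpow_natCast (b * η) n,
          ← Real.rpow_mul (by positivity), mul_comm (n : ℝ) γ, Real.rpow_mul (by positivity),
          hbη, Real.rpow_natCast, pow_succ', ← mul_assoc, ← mul_assoc]
        gcongr
      · rw [← Real.rpow_mul hQ0.le, one_div_mul_cancel hp.ne', Real.rpow_one]
        set c : ℝ := 4 * 2 ^ n with hc
        have hcr : c ^ (r - 1) = 4 ^ (r - 1) * b ^ n := by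
          rw [hc, Real.mul_rpow (by norm_num) (by positivity), hb, ← Real.rpow_natCast,
            ← Real.rpow_natCast, ← Real.rpow_mul (by norm_num), ← Real.rpow_mul (by norm_num),
            mul_comm (n : ℝ)]
        have hpt : ∀ x, u x ^ (q - 1) * max (u x - κ (n + 1)) 0 ≤
            2 ^ (q - 1) * c ^ (r - 1) * M ^ (-(r - q)) * max (u x - κ n) 0 ^ r := fun x ↦ by
          refine truncation_step_pointwise hq hqr (hu0 x) hM0 ?_ (hκM n) ?_
          · have : (1 : ℝ) ≤ 2 ^ n := one_le_pow₀ (by norm_num)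
            linarith
          · simp only [hκ, hc, one_div, inv_pow, pow_succ]
            field_simp
            ring
        calc ENNReal.ofReal C *
              ∫⁻ x, ENNReal.ofReal (u x ^ (q - 1) * max (u x - κ (n + 1)) 0) ∂ν
            ≤ ENNReal.ofReal C * ∫⁻ x, ENNReal.ofReal (2 ^ (q - 1) * c ^ (r - 1)
                * M ^ (-(r - q))) * ENNReal.ofReal (max (u x - κ n) 0 ^ r) ∂ν := by
              gcongr with x
              rw [← ENNReal.ofReal_mul (by positivity)]
              exact ENNReal.ofReal_le_ofReal (hpt x)
          _ ≤ ENNReal.ofReal C * (ENNReal.ofReal (2 ^ (q - 1) * c ^ (r - 1)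
                * M ^ (-(r - q))) * ENNReal.ofReal (A * η ^ n)) := by
              rw [lintegral_const_mul' _ _ ENNReal.ofReal_ne_top]
              gcongr
          _ = ENNReal.ofReal Q := by
              rw [← ENNReal.ofReal_mul (by positivity), ← ENNReal.ofReal_mul hC.le, hcr, hQ, hD,
                mul_pow]
              congr 1
              ring
  refine ⟨M, ?_⟩
  have hzero : ∫⁻ x, ENNReal.ofReal (max (u x - M) 0 ^ r) ∂ν = 0 := by
    refine le_antisymm ?_ zero_le
    have hlim : Filter.Tendsto (fun n : ℕ ↦ ENNReal.ofReal (A * η ^ n)) Filter.atTop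
        (nhds 0) := by
      simpa using ENNReal.tendsto_ofReal
        ((tendsto_pow_atTop_nhds_zero_of_lt_one hη0.le hη1).const_mul A)
    refine ge_of_tendsto' hlim fun n ↦ le_trans ?_ (hY n)
    gcongr with x
    exact hκM n
  rw [lintegral_eq_zero_iff (by fun_prop)] at hzero
  filter_upwards [hzero] with x hx
  by_contra hlt
  push Not at hlt
  have : 0 < max (u x - M) 0 ^ r := Real.rpow_pos_of_pos (lt_max_of_lt_left (by linarith)) _
  simp only [Pi.zero_apply, ENNReal.ofReal_eq_zero] at hx
  linarith

/-! ### Null-set invariance, truncations and the Caccioppoli inequality -/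

theorem gagliardoSeminorm_eq {d : ℕ} (s p : ℝ) (u : EuclideanSpace ℝ (Fin d) → ℝ) :
    gagliardoSeminorm s p u = gagliardoEnergy s p u ^ (1 / p) := rfl

theorem ae_prod_eq_of_ae_eq {d : ℕ} {u w : EuclideanSpace ℝ (Fin d) → ℝ} (h : u =ᵐ[volume] w) :
    ∀ᵐ z : EuclideanSpace ℝ (Fin d) × EuclideanSpace ℝ (Fin d),
      u z.1 = w z.1 ∧ u z.2 = w z.2 := by
  rw [Measure.volume_eq_prod]
  exact (Measure.quasiMeasurePreserving_fst.ae h).and (Measure.quasiMeasurePreserving_snd.ae h)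

theorem gagliardoEnergy_congr_ae {d : ℕ} {s p : ℝ} {u w : EuclideanSpace ℝ (Fin d) → ℝ}
    (h : u =ᵐ[volume] w) : gagliardoEnergy s p u = gagliardoEnergy s p w := by
  refine lintegral_congr_ae ?_
  filter_upwards [ae_prod_eq_of_ae_eq h] with z hz
  rw [hz.1, hz.2]

theorem weakForm_congr_ae {d : ℕ} {s p : ℝ} {u w φ : EuclideanSpace ℝ (Fin d) → ℝ}
    (h : u =ᵐ[volume] w) : weakForm s p u φ = weakForm s p w φ := by
  refine integral_congr_ae ?_
  filter_upwards [ae_prod_eq_of_ae_eq h] with z hz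
  rw [hz.1, hz.2]

theorem MemW0.congr_ae {d : ℕ} {s p : ℝ} {Ω : Set (EuclideanSpace ℝ (Fin d))}
    {u w : EuclideanSpace ℝ (Fin d) → ℝ} (hu : MemW0 s p Ω u) (h : u =ᵐ[volume] w) :
    MemW0 s p Ω w where
  memLp := hu.memLp.ae_eq h
  seminorm_lt_top := by
    rw [gagliardoSeminorm_eq, ← gagliardoEnergy_congr_ae h]
    exact hu.seminorm_lt_top
  eq_zero_outside := by
    filter_upwards [hu.eq_zero_outside, h] with x hx hx' hxΩ
    rw [← hx', hx hxΩ]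

theorem IsWeakSolution.congr_ae {d : ℕ} {s p q lam : ℝ} {Ω : Set (EuclideanSpace ℝ (Fin d))}
    {u w : EuclideanSpace ℝ (Fin d) → ℝ} (hu : IsWeakSolution s p q lam Ω u)
    (h : u =ᵐ[volume] w) : IsWeakSolution s p q lam Ω w where
  memW0 := hu.memW0.congr_ae h
  weak_eq φ hφ := by
    rw [← weakForm_congr_ae h, hu.weak_eq φ hφ]
    congr 1
    refine integral_congr_ae (ae_restrict_of_ae ?_)
    filter_upwards [h] with x hx
    rw [hx]

theorem MemW0.gagliardoEnergy_lt_top {d : ℕ} {s p : ℝ} {Ω : Set (EuclideanSpace ℝ (Fin d))}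
    {u : EuclideanSpace ℝ (Fin d) → ℝ} (hp : 0 < p) (hu : MemW0 s p Ω u) :
    gagliardoEnergy s p u < ∞ := by
  have h := hu.seminorm_lt_top
  rw [gagliardoSeminorm_eq] at h
  exact (ENNReal.rpow_lt_top_iff_of_pos (by positivity)).mp h

theorem abs_posPart_sub_le (a b k : ℝ) : |max (a - k) 0 - max (b - k) 0| ≤ |a - b| := by
  simpa using abs_max_sub_max_le_abs (a - k) (b - k) 0

theorem MemW0.truncation {d : ℕ} {s p : ℝ} {Ω : Set (EuclideanSpace ℝ (Fin d))}
    {u : EuclideanSpace ℝ (Fin d) → ℝ} (hp : 0 < p) (hu : MemW0 s p Ω u) (hum : Measurable u)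
    {k : ℝ} (hk : 0 ≤ k) : MemW0 s p Ω (fun x ↦ max (u x - k) 0) where
  memLp := by
    refine hu.memLp.mono (by fun_prop) (Filter.Eventually.of_forall fun x ↦ ?_)
    rw [Real.norm_eq_abs, Real.norm_eq_abs, abs_of_nonneg (le_max_right _ _)]
    exact max_le (by linarith [le_abs_self (u x)]) (abs_nonneg _)
  seminorm_lt_top := by
    rw [gagliardoSeminorm_eq]
    refine ENNReal.rpow_lt_top_of_nonneg (by positivity) (ne_top_of_le_ne_top
      (hu.gagliardoEnergy_lt_top hp).ne (lintegral_mono fun z ↦ ENNReal.ofReal_le_ofReal ?_))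
    exact div_le_div_of_nonneg_right (Real.rpow_le_rpow (abs_nonneg _)
      (abs_posPart_sub_le _ _ _) hp.le) (by positivity)
  eq_zero_outside := by
    filter_upwards [hu.eq_zero_outside] with x hx hxΩ
    rw [hx hxΩ]
    exact max_eq_right (by linarith)

/-- The pairing equals |a|^(p-1) |b|. With a, b the increments of u and of its truncation, the lower
bound yields the truncated energy and the upper bound the integrability of the weak form. -/
theorem rpow_le_duality_pairing_le {p a b : ℝ} (hp : 1 < p) (hab : 0 ≤ a * b) (hba : |b| ≤ |a|) :
    |b| ^ p ≤ |a| ^ (p - 2) * a * b ∧ |a| ^ (p - 2) * a * b ≤ |a| ^ p := by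
  rcases eq_or_ne a 0 with rfl | ha
  · have hb : b = 0 := by simpa using hba
    simp [hb, Real.zero_rpow (by linarith : p ≠ 0)]
  · have ha0 : 0 < |a| := abs_pos.mpr ha
    have h1 : |a| ^ (p - 2) * a * b = |a| ^ (p - 1) * |b| := by
      rw [mul_assoc, ← abs_of_nonneg hab, abs_mul, ← mul_assoc, ← Real.rpow_add_one ha0.ne']
      ring_nf
    have h2 : ∀ x : ℝ, 0 ≤ x → x ^ p = x ^ (p - 1) * x := fun x hx ↦ by
      rw [← Real.rpow_add_one' hx (by linarith)]
      ring_nf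
    rw [h1, h2 _ (abs_nonneg b), h2 _ (abs_nonneg a)]
    have h3 : |b| ^ (p - 1) ≤ |a| ^ (p - 1) :=
      Real.rpow_le_rpow (abs_nonneg b) hba (by linarith)
    exact ⟨by gcongr, by gcongr⟩

/-- Caccioppoli inequality: testing the equation with the truncation `(u - k)₊`. -/
theorem IsWeakSolution.gagliardoEnergy_truncation_le {d : ℕ} {s p q lam : ℝ}
    {Ω : Set (EuclideanSpace ℝ (Fin d))} {u : EuclideanSpace ℝ (Fin d) → ℝ} (hp : 1 < p)
    (hu : IsWeakSolution s p q lam Ω u) (hum : Measurable u) (hu0 : ∀ x, 0 ≤ u x) {k : ℝ}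
    (hk : 0 ≤ k) :
    gagliardoEnergy s p (fun x ↦ max (u x - k) 0) ≤
      ENNReal.ofReal |lam| * ∫⁻ x, ENNReal.ofReal (u x ^ (q - 1) * max (u x - k) 0) := by
  have hp0 : 0 < p := by linarith
  set φ : EuclideanSpace ℝ (Fin d) → ℝ := fun x ↦ max (u x - k) 0 with hφ
  have hφm : Measurable φ := by fun_prop
  have hpt : ∀ x y, |φ x - φ y| ^ p ≤ |u x - u y| ^ (p - 2) * (u x - u y) * (φ x - φ y) ∧
      |u x - u y| ^ (p - 2) * (u x - u y) * (φ x - φ y) ≤ |u x - u y| ^ p := by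
    intro x y
    refine rpow_le_duality_pairing_le hp ?_ (abs_posPart_sub_le _ _ _)
    rcases le_total (u x) (u y) with h | h
    · exact mul_nonneg_of_nonpos_of_nonpos (by linarith)
        (sub_nonpos.mpr (max_le_max_right _ (by linarith)))
    · exact mul_nonneg (by linarith) (sub_nonneg.mpr (max_le_max_right _ (by linarith)))
  set F : EuclideanSpace ℝ (Fin d) × EuclideanSpace ℝ (Fin d) → ℝ := fun z ↦
    |u z.1 - u z.2| ^ (p - 2) * (u z.1 - u z.2) * (φ z.1 - φ z.2) /
      ‖z.1 - z.2‖ ^ ((d : ℝ) + s * p) with hF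
  have hF0 : ∀ z, 0 ≤ F z := fun z ↦
    div_nonneg (le_trans (by positivity) (hpt z.1 z.2).1) (by positivity)
  -- Without integrability the Bochner integral in `weakForm` would default to 0 and carry no
  -- information.
  have hFint : Integrable F := by
    refine ⟨Measurable.aestronglyMeasurable (by fun_prop), ?_⟩
    rw [hasFiniteIntegral_iff_ofReal (Filter.Eventually.of_forall hF0)]
    refine lt_of_le_of_lt (lintegral_mono fun z ↦ ENNReal.ofReal_le_ofReal ?_)
      (hu.memW0.gagliardoEnergy_lt_top hp0)
    exact div_le_div_of_nonneg_right (hpt z.1 z.2).2 (by positivity)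
  calc gagliardoEnergy s p φ ≤ ∫⁻ z, ENNReal.ofReal (F z) := by
        refine lintegral_mono fun z ↦ ENNReal.ofReal_le_ofReal ?_
        exact div_le_div_of_nonneg_right (hpt z.1 z.2).1 (by positivity)
    _ = ENNReal.ofReal (weakForm s p u φ) :=
        (ofReal_integral_eq_lintegral_ofReal hFint (Filter.Eventually.of_forall hF0)).symm
    _ = ENNReal.ofReal (lam * ∫ x in Ω, |u x| ^ (q - 2) * u x * φ x) := by
        rw [hu.weak_eq φ (hu.memW0.truncation hp0 hum hk)]
    -- Passing to norms covers every sign of `lam` and needs no integrability of the right-hand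
    -- side.
    _ ≤ ‖lam * ∫ x in Ω, |u x| ^ (q - 2) * u x * φ x‖ₑ := by
        rw [← ofReal_norm]
        exact ENNReal.ofReal_le_ofReal (Real.le_norm_self _)
    _ ≤ ENNReal.ofReal |lam| * ∫⁻ x in Ω, ‖|u x| ^ (q - 2) * u x * φ x‖ₑ := by
        rw [enorm_mul, ← ofReal_norm lam, Real.norm_eq_abs]
        gcongr
        exact enorm_integral_le_lintegral_enorm _
    _ ≤ ENNReal.ofReal |lam| * ∫⁻ x, ‖|u x| ^ (q - 2) * u x * φ x‖ₑ := by
        gcongr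
        exact Measure.restrict_le_self
    _ ≤ _ := by
        gcongr with x
        rcases (hu0 x).eq_or_lt with h | h
        · simp [← h]
        · have hφ0 : 0 ≤ φ x := le_max_right _ _
          rw [abs_of_pos h, ← Real.rpow_add_one h.ne', ← ofReal_norm,
            Real.norm_of_nonneg (by positivity)]
          ring_nf
          exact le_rfl

/-! ### Choice of exponents and conclusion -/

/-- For θ = sp/d < 1, p/(1-θ) is exactly the critical exponent. If sp ≥ d, every θ < 1 is
admissible, and θ = q/(p+q) gives p/(1-θ) = p + q. -/
theorem exists_exponent_of_lt_criticalExponent {d : ℕ} {s p q : ℝ} (hd : 1 ≤ d)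
    (hs : 0 < s) (hp : 0 < p) (hq : 0 < q) (hqp : (q : EReal) < criticalExponent d s p) :
    ∃ θ : ℝ, 0 < θ ∧ θ < 1 ∧ θ ≤ s * p / d ∧ q < p / (1 - θ) := by
  have hd0 : (0 : ℝ) < d := by exact_mod_cast hd
  rw [criticalExponent] at hqp
  split_ifs at hqp with h
  · rw [EReal.coe_lt_coe_iff] at hqp
    refine ⟨s * p / d, by positivity, (div_lt_one hd0).mpr h, le_rfl, hqp.trans_eq ?_⟩
    have : (d : ℝ) - s * p ≠ 0 := by linarith
    rw [one_sub_div hd0.ne']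
    field_simp
  · have hθ1 : q / (p + q) < 1 := (div_lt_one (by positivity)).mpr (by linarith)
    refine ⟨q / (p + q), by positivity, hθ1, hθ1.le.trans ?_, ?_⟩
    · rw [one_le_div hd0]
      linarith
    · rw [one_sub_div (by positivity), add_sub_cancel_right, div_div_cancel₀ hp.ne']
      linarith

theorem MemW0.exists_measurable_nonneg_ae_eq {d : ℕ} {s p : ℝ}
    {Ω : Set (EuclideanSpace ℝ (Fin d))} {u : EuclideanSpace ℝ (Fin d) → ℝ}
    (hΩ : MeasurableSet Ω) (hu : MemW0 s p Ω u) (hu0 : ∀ᵐ x, 0 ≤ u x) :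
    ∃ w : EuclideanSpace ℝ (Fin d) → ℝ, Measurable w ∧ (∀ x, 0 ≤ w x) ∧ (∀ x ∉ Ω, w x = 0) ∧
      u =ᵐ[volume] w := by
  have hum := hu.memLp.aestronglyMeasurable.aemeasurable
  refine ⟨Ω.indicator fun x ↦ max (hum.mk u x) 0,
    (hum.measurable_mk.max measurable_const).indicator hΩ,
    fun x ↦ Set.indicator_nonneg (fun _ _ ↦ le_max_right _ _) x,
    fun x hx ↦ Set.indicator_of_notMem hx _, ?_⟩
  filter_upwards [hu0, hum.ae_eq_mk, hu.eq_zero_outside] with x h0 hmk hout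
  by_cases hx : x ∈ Ω
  · rw [Set.indicator_of_mem hx, ← hmk, max_eq_left h0]
  · rw [Set.indicator_of_notMem hx, hout hx]

end FracPLap

theorem proposition2p3 (d : ℕ) (hd : 1 ≤ d) (p s q lam : ℝ) (hp : 1 < p)
    (hs0 : 0 < s) (hs1 : s < 1) (hq : 1 ≤ q)
    (hqp : (q : EReal) < FracPLap.criticalExponent d s p)
    (Ω : Set (EuclideanSpace ℝ (Fin d))) (hΩ : IsOpen Ω) (hΩb : Bornology.IsBounded Ω)
    (u : EuclideanSpace ℝ (Fin d) → ℝ) (hu : FracPLap.IsWeakSolution s p q lam Ω u)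
    (hu0 : ∀ᵐ x ∂(volume : Measure (EuclideanSpace ℝ (Fin d))), 0 ≤ u x) :
    MemLp u ∞ volume := by
  have hp0 : 0 < p := by linarith
  obtain ⟨w, hwm, hw0, hwΩ, huw⟩ :=
    hu.memW0.exists_measurable_nonneg_ae_eq hΩ.measurableSet hu0
  have hw := hu.congr_ae huw
  obtain ⟨θ, hθ0, hθ1, hθ, hqθ⟩ :=
    FracPLap.exists_exponent_of_lt_criticalExponent hd hs0 hp0 (by linarith) hqp
  have hpθ : p < p / (1 - θ) := by
    rw [lt_div_iff₀ (by linarith)]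
    nlinarith
  -- r > p makes the iteration superlinear, r > q makes large M effective, and r < p/(1-θ) keeps
  -- Sobolev available.
  obtain ⟨r, hr, hrθ⟩ := exists_between (max_lt hpθ hqθ)
  have hpr : p < r := (le_max_left _ _).trans_lt hr
  have hqr : q < r := (le_max_right _ _).trans_lt hr
  obtain ⟨S, hS⟩ := FracPLap.exists_lintegral_rpow_le_of_gagliardoEnergy_le hd hs0 hp0 hθ0 hθ1 hθ
    (by linarith) hrθ hΩb
  have hwr : ∫⁻ x, ENNReal.ofReal (w x ^ r) < ∞ := by
    have hE := hw.memW0.gagliardoEnergy_lt_top hp0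
    refine (hS w hwm hw0 hwΩ (((FracPLap.gagliardoEnergy s p w).toReal + 1) ^ (1 / p)) (by positivity)
      ?_).trans_lt ENNReal.ofReal_lt_top
    rw [← Real.rpow_mul (by positivity), one_div_mul_cancel hp0.ne', Real.rpow_one,
      ENNReal.le_ofReal_iff_toReal_le hE.ne (by positivity)]
    linarith
  -- The added 1 keeps C positive when `lam` is 0.
  obtain ⟨M, hM⟩ := FracPLap.ae_le_of_truncation_estimate (C := |lam| + 1) hp0 hq hqr hpr (by positivity)
    hwm hw0 hwr fun k K hk hK hle ↦ by
      refine hS (fun x ↦ max (w x - k) 0) (by fun_prop) (fun _ ↦ le_max_right _ _)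
        (fun x hx ↦ ?_) K hK ?_
      · rw [hwΩ x hx]
        exact max_eq_right (by linarith)
      · refine ((hw.gagliardoEnergy_truncation_le hp hwm hw0 hk).trans ?_).trans hle
        gcongr
        linarith
  refine memLp_top_of_bound hu.memW0.memLp.aestronglyMeasurable M ?_
  filter_upwards [huw, hM] with x hx hxM
  rw [hx, Real.norm_of_nonneg (hw0 x)]
  exact hxM
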